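/- Let $\mathscr H,\mathscr U$ be complex Hilbert spaces, $\mathbb T=(\mathbb T_t)_{t\ge0}$ a strongly continuous semigroup on $\mathscr H$ with generator $\mathcal A$, and $\mathcal B$ an admissible control operator for $\mathbb T$; that is, $\mathcal B$ is a bounded linear operator from $\mathscr U$ to $\mathscr H_{-1}$, the completion of $\mathscr H$ in the norm $\|(\beta-\mathcal A)^{-1}z\|$ with $\beta\in\rho(\mathcal A)$, and for some $\tau>0$ one has $F_\tau u\in\mathscr H$ for all $u\in L^2([0,\infty);\mathscr U)$, where $F_tu=\int_0^t\mathbb T_{t-\sigma}\mathcal B u(\sigma)\,d\sigma$. Let $T>0$, $x_0,x_T\in\mathscr H$, let $U\subseteq L^2((0,T);\mathscr U)$ be closed and convex, and let $\theta\colon\mathscr H\times\mathscr U\times[0,T]\to\mathbb R$ and $g_j\colon\mathscr H\times[0,T]\to\mathbb R$, $j\in J=\{1,\dots,l\}$, be given. Put $X=C([0,T];\mathscr H)\times L^2((0,T);\mathscr U)$ with the norm $\|x\|_C+\|u\|_{L^2}$, $\mathcal I(x,u)=\int_0^T\theta(x(t),u(t),t)\,dt$, $$M=\{(x,u)\in X: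 g_j(x(t),t)\le0\ \ \forall t\in[0,T],\ j\in J\},$$ $$A=\{(x,u)\in X: x(0)=x_0,\ x(T)=x_T,\ u\in U,\ x(t)=\mathbb T_tx_0+F_tu\ \ \forall t\in[0,T]\},$$ and consider the problem $(\mathcal P)$ of minimising $\mathcal I$ over $\Omega=M\cap A$. Assume that: (i) $\theta$ is continuous, and for every $R>0$ there are $C_R>0$ and an a.e. nonnegative $\omega_R\in L^1(0,T)$ with $|\theta(x,u,t)|\le C_R\|u\|^2+\omega_R(t)$ for all $x$ with $\|x\|\le R$, all $u\in\mathscr U$ and all $t\in(0,T)$; (ii) $(x,u)\mapsto\theta(x,u,t)$ is convex for every $t\in[0,T]$; (iii) $(\mathcal P)$ has a globally optimal solution $(x^*,u^*)$; (iv) each $g_j$ is convex in $x$ and jointly continuous in $(x,t)$, and Slater's condition holds: there is $(\widehat x,\widehat u)\in A$ with $g_j(\widehat x(t),t)<0$ for all $t\in[0,T]$ and $j\in J$; (v) for some $1\le p<\infty$ there are Lagrange multipliers, i.e. (nonnegative) regular Borel measures $\mu_1,\dots,\mu_l$ on $[0,T]$ with $$\mathcal I(x,u)+\sum_{j=1}^l\int_{[0,T]}g_j(x(t),t)\,d\mu_j(t)\ge\mathcal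 I(x^*,u^*)\qquad\forall (x,u)\in A,$$ which are absolutely continuous with respect to the Lebesgue measure and whose Radon–Nikodym derivatives belong to $L^{p'}[0,T]$, where $1/p+1/p'=1$. For $\lambda\ge0$ let $$\Phi_\lambda(x,u)=\mathcal I(x,u)+\lambda\sum_{j=1}^l\Big(\int_0^T\max\{g_j(x(t),t),0\}^p\,dt\Big)^{1/p}.$$ Then there is $\lambda^*\ge0$ such that for every $\lambda\ge\lambda^*$ the penalty function $\Phi_\lambda$ is completely exact on $A$, that is: (1) $\inf_{\Omega}\mathcal I=\inf_A\Phi_\lambda$; (2) the globally optimal solutions of $(\mathcal P)$ and those of the problem of minimising $\Phi_\lambda$ over $A$ coincide; (3) a point $z\in A$ is a local minimiser of $\Phi_\lambda$ on $A$ if and only if $z\in\Omega$ and $z$ is a local minimiser of $\mathcal I$ on $\Omega$; (4) a point $z\in A$ is an inf-stationary point of $\Phi_\lambda$ on $A$ if and only if $z\in\Omega$ and $z$ is an inf-stationary point of $\mathcal I$ on $\Omega$. Here $z\in K$ is an inf-stationary point of $f$ on $K$ if $\liminf_{y\to z,\ y\in K,\ y\ne z}\frac{f(y)-f(z)}{\|y-z\|_X}\ge0$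 (the lower limit being $+\infty$ when $z$ is isolated in $K$). -/

import Mathlib

open MeasureTheory Set Filter Topology
open scoped NNReal ENNReal

noncomputable section

namespace ExactPenalty

/-! ### Penalty functions in metric spaces -/

section Metric

variable {X : Type*} [MetricSpace X]

/-- The rate of steepest descent of `f` with respect to `K` at `x`:
the lower limit of `(f y - f x) / d(y, x)` as `y → x`, `y ∈ K`, `y ≠ x`.
It equals `⊤` when `x` is an isolated point of `K`. -/
def steepestDescentRate (f : X → ℝ) (K : Set X) (x : X) : EReal :=
  liminf (fun y => (((f y - f x) / dist y x : ℝ) : EReal)) (𝓝[K \ {x}] x)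

/-- `x` is an inf-stationary point of `f` on `K`. -/
def IsInfStationary (f : X → ℝ) (K : Set X) (x : X) : Prop :=
  x ∈ K ∧ 0 ≤ steepestDescentRate f K x

/-- `x` is a globally optimal solution of minimising `f` over `K`. -/
def IsGlobalSolution (f : X → ℝ) (K : Set X) (x : X) : Prop :=
  x ∈ K ∧ IsMinOn f K x

/-- `x` is a locally optimal solution of minimising `f` over `K`. -/
def IsLocalSolution (f : X → ℝ) (K : Set X) (x : X) : Prop :=
  x ∈ K ∧ IsLocalMinOn f K x

/-- For the problem of minimising `I` over `M ∩ A` and its penalisation, minimising `Phi` over `A`,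
the four properties whose conjunction is complete exactness on the set `S`. -/
structure IsCompletelyExactOn (I Phi : X → ℝ) (M A S : Set X) : Prop where
  optimalValue_eq : (⨅ x ∈ M ∩ A, (I x : EReal)) = ⨅ x ∈ A, (Phi x : EReal)
  globalSolution_iff : ∀ x, IsGlobalSolution Phi A x ↔ IsGlobalSolution I (M ∩ A) x
  localSolution_iff : ∀ x ∈ S, IsLocalSolution Phi A x ↔ IsLocalSolution I (M ∩ A) x
  infStationary_iff : ∀ x ∈ S, IsInfStationary Phi A x ↔ IsInfStationary I (M ∩ A) x

end Metric

/-! ### Strongly continuous semigroups, the extrapolation space, admissible control operators -/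

/-- A strongly continuous semigroup of bounded linear operators. -/
structure C0Semigroup (H : Type*) [NormedAddCommGroup H] [NormedSpace ℂ H] where
  op : ℝ≥0 → H →L[ℂ] H
  op_zero : op 0 = ContinuousLinearMap.id ℂ H
  op_add : ∀ s t, op (s + t) = (op s).comp (op t)
  continuous_orbit : ∀ z, Continuous fun t => op t z

section Resolvent

/-- The space `H` with the (semi)norm `‖R z‖`, where `R` is a bounded operator. -/
def ResolventNormed {H : Type*} [NormedAddCommGroup H] [NormedSpace ℂ H] (_R : H →L[ℂ] H) :
    Type _ := H

variable {H : Type*} [NormedAddCommGroup H] [NormedSpace ℂ H]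

instance (R : H →L[ℂ] H) : AddCommGroup (ResolventNormed R) :=
  inferInstanceAs (AddCommGroup H)

instance (R : H →L[ℂ] H) : Module ℂ (ResolventNormed R) :=
  inferInstanceAs (Module ℂ H)

/-- The identity map from `H` to `H` with the norm `‖R z‖`. -/
def toResolventNormed (R : H →L[ℂ] H) : H ≃ₗ[ℂ] ResolventNormed R := LinearEquiv.refl ℂ H

/-- `R`, as a map defined on `H` with the norm `‖R z‖`. -/
def ResolventNormed.map (R : H →L[ℂ] H) : ResolventNormed R →ₗ[ℂ] H :=
  (R : H →ₗ[ℂ] H).comp ((toResolventNormed R).symm : ResolventNormed R →ₗ[ℂ] H)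

instance (R : H →L[ℂ] H) : SeminormedAddCommGroup (ResolventNormed R) :=
  SeminormedAddCommGroup.induced _ _ (ResolventNormed.map R)

instance (R : H →L[ℂ] H) : NormedSpace ℂ (ResolventNormed R) :=
  NormedSpace.induced ℂ _ _ (ResolventNormed.map R)

theorem ResolventNormed.norm_def (R : H →L[ℂ] H) (z : H) :
    ‖toResolventNormed R z‖ = ‖R z‖ := rfl

end Resolvent

namespace C0Semigroup

variable {H : Type*} [NormedAddCommGroup H] [NormedSpace ℂ H] (S : C0Semigroup H)

/-- The graph of the generator: the pairs `(z, w)` with `(T_h z - z) / h → w` as `h → 0+`. -/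
def generatorGraph : Submodule ℂ (H × H) where
  carrier := {q | Tendsto (fun h : ℝ≥0 => ((h : ℝ) : ℂ)⁻¹ • (S.op h q.1 - q.1)) (𝓝[>] 0) (𝓝 q.2)}
  zero_mem' := by simp
  add_mem' := by
    intro a b ha hb
    refine (Tendsto.add ha hb).congr fun h => ?_
    simp only [Prod.fst_add, map_add, ← smul_add]
    congr 1
    abel
  smul_mem' := by
    intro c a ha
    refine (Tendsto.const_smul ha c).congr fun h => ?_
    simp only [Prod.smul_fst, map_smul, ← smul_sub]
    rw [smul_comm]

/-- The infinitesimal generator of the semigroup. -/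
def generator : H →ₗ.[ℂ] H := S.generatorGraph.toLinearPMap

theorem generatorGraph_functional (q : H × H) (hq : q ∈ S.generatorGraph) (h0 : q.1 = 0) :
    q.2 = 0 := by
  have hq' : Tendsto (fun h : ℝ≥0 => ((h : ℝ) : ℂ)⁻¹ • (S.op h q.1 - q.1)) (𝓝[>] 0) (𝓝 q.2) := hq
  simp only [h0, map_zero, sub_zero, smul_zero] at hq'
  exact tendsto_nhds_unique hq' tendsto_const_nhds

theorem graph_generator : S.generator.graph = S.generatorGraph :=
  Submodule.toLinearPMap_graph_eq _ fun q hq h0 => S.generatorGraph_functional q hq h0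

/-- `R` is a bounded two-sided inverse of `β - A : D(A) → H`, where `A` is the generator. -/
def IsResolventAt (β : ℂ) (R : H →L[ℂ] H) : Prop :=
  (∀ z : H, ∃ hz : R z ∈ S.generator.domain, β • R z - S.generator ⟨R z, hz⟩ = z) ∧
    ∀ z : S.generator.domain, R (β • (z : H) - S.generator z) = z

/-- The resolvent set of the generator. -/
def resolventSet : Set ℂ := {β | ∃ R, S.IsResolventAt β R}

open Classical in
/-- The resolvent `(β - A)⁻¹` for `β` in the resolvent set (and `0` for other `β`). -/
def resolvent (β : ℂ) : H →L[ℂ] H :=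
  if h : ∃ R, S.IsResolventAt β R then h.choose else 0

theorem resolvent_spec {β : ℂ} (hβ : β ∈ S.resolventSet) : S.IsResolventAt β (S.resolvent β) := by
  have h : ∃ R, S.IsResolventAt β R := hβ
  rw [resolvent, dif_pos h]
  exact h.choose_spec

theorem op_comm (s t : ℝ≥0) (z : H) : S.op s (S.op t z) = S.op t (S.op s z) := by
  have h := S.op_add s t
  rw [add_comm, S.op_add t s] at h
  exact (congrArg (fun f : H →L[ℂ] H => f z) h).symm

theorem op_mem_graph (t : ℝ≥0) {z w : H} (h : (z, w) ∈ S.generatorGraph) :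
    (S.op t z, S.op t w) ∈ S.generatorGraph := by
  have h' : Tendsto (fun h : ℝ≥0 => ((h : ℝ) : ℂ)⁻¹ • (S.op h z - z)) (𝓝[>] 0) (𝓝 w) := h
  change Tendsto (fun h : ℝ≥0 => ((h : ℝ) : ℂ)⁻¹ • (S.op h (S.op t z) - S.op t z)) (𝓝[>] 0)
    (𝓝 (S.op t w))
  refine (((S.op t).continuous.tendsto w).comp h').congr fun r => ?_
  simp [map_sub, S.op_comm t r]

theorem resolvent_op (β : ℂ) (t : ℝ≥0) (z : H) :
    S.resolvent β (S.op t z) = S.op t (S.resolvent β z) := by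
  by_cases hβ : β ∈ S.resolventSet
  · obtain ⟨h1, h2⟩ := S.resolvent_spec hβ
    obtain ⟨hz, hzeq⟩ := h1 z
    have hg : (S.resolvent β z, S.generator ⟨S.resolvent β z, hz⟩) ∈ S.generatorGraph := by
      rw [← S.graph_generator]
      exact LinearPMap.mem_graph _ ⟨S.resolvent β z, hz⟩
    have hg' := S.op_mem_graph t hg
    rw [← S.graph_generator, LinearPMap.mem_graph_iff] at hg'
    obtain ⟨y, hy1, hy2⟩ := hg'
    have hy := h2 y
    simp only at hy1 hy2
    rw [hy2, hy1, ← map_smul, ← map_sub, hzeq] at hy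
    exact hy
  · have h : ¬ ∃ R, S.IsResolventAt β R := hβ
    simp [resolvent, dif_neg h]

/-- The extrapolation space `H₋₁`: the completion of `H` with respect to the norm
`‖(β - A)⁻¹ z‖`, where `β` belongs to the resolvent set of the generator `A`.
Different choices of `β` give equivalent norms. -/
abbrev Extrapolation (β : ℂ) : Type _ :=
  UniformSpace.Completion (ResolventNormed (S.resolvent β))

/-- The canonical map `H → H₋₁`. -/
def embed (β : ℂ) (z : H) : S.Extrapolation β :=
  (toResolventNormed (S.resolvent β) z : ResolventNormed (S.resolvent β))

/-- The operator `T_t`, as a bounded operator on `H` with the norm `‖(β - A)⁻¹ z‖`. -/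
def opResolventNormed (β : ℂ) (t : ℝ≥0) :
    ResolventNormed (S.resolvent β) →L[ℂ] ResolventNormed (S.resolvent β) :=
  LinearMap.mkContinuous
    (((toResolventNormed (S.resolvent β)).toLinearMap.comp (S.op t).toLinearMap).comp
      (toResolventNormed (S.resolvent β)).symm.toLinearMap) ‖S.op t‖ fun z => by
    obtain ⟨w, rfl⟩ := (toResolventNormed (S.resolvent β)).surjective z
    have h : ‖S.resolvent β (S.op t w)‖ ≤ ‖S.op t‖ * ‖S.resolvent β w‖ := by
      rw [S.resolvent_op]
      exact (S.op t).le_opNorm _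
    exact h

/-- The continuous extension of `T_t` to `H₋₁`. -/
def opExtrapolation (β : ℂ) (t : ℝ≥0) : S.Extrapolation β →L[ℂ] S.Extrapolation β :=
  (S.opResolventNormed β t).completion

theorem opExtrapolation_embed (β : ℂ) (t : ℝ≥0) (z : H) :
    S.opExtrapolation β t (S.embed β z) = S.embed β (S.op t z) :=
  UniformSpace.Completion.map_coe (S.opResolventNormed β t).uniformContinuous _

variable {𝒰 : Type*} [NormedAddCommGroup 𝒰] [NormedSpace ℂ 𝒰]

/-- The input map `F_t u = ∫₀ᵗ T_{t-σ} B u(σ) dσ`, computed in `H₋₁`. -/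
def inputMap {β : ℂ} (B : 𝒰 →L[ℂ] S.Extrapolation β) (t : ℝ) (u : ℝ → 𝒰) : S.Extrapolation β :=
  ∫ σ in (0 : ℝ)..t, S.opExtrapolation β (t - σ).toNNReal (B (u σ))

/-- `B ∈ L(𝒰, H₋₁)` is an admissible control operator: for some `τ > 0` the values `F_τ u` with
`u ∈ L²([0, ∞); 𝒰)` lie in `H`. -/
def IsAdmissible {β : ℂ} (B : 𝒰 →L[ℂ] S.Extrapolation β) : Prop :=
  ∃ τ : ℝ, 0 < τ ∧ ∀ u : Lp 𝒰 2 (volume.restrict (Ici (0 : ℝ))),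
    S.inputMap B τ u ∈ range (S.embed β)

end C0Semigroup

/-! ### The state-constrained problem -/

/-- Lebesgue measure on `[0, T]`. -/
def lebesgueOn (T : ℝ) : Measure (Icc (0 : ℝ) T) := volume.comap Subtype.val

/-- `X = C([0, T]; H) × L²((0, T); 𝒰)` with the norm `‖x‖_C + ‖u‖_{L²}`. -/
abbrev StateControl (H 𝒰 : Type*) [NormedAddCommGroup H] [NormedAddCommGroup 𝒰] (T : ℝ) : Type _ :=
  WithLp 1 (C(Icc (0 : ℝ) T, H) × Lp 𝒰 2 (volume.restrict (Ioo (0 : ℝ) T)))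

/-- The data of the problem: minimise `∫₀ᵀ θ(x(t), u(t), t) dt` subject to `x' = A x + B u`,
`x(0) = x₀`, `x(T) = x_T`, `u ∈ U`, and `g_j(x(t), t) ≤ 0` for all `t ∈ [0, T]` and `j`. -/
structure Problem (H 𝒰 : Type*) [NormedAddCommGroup H] [InnerProductSpace ℂ H]
    [NormedAddCommGroup 𝒰] [InnerProductSpace ℂ 𝒰] (l : ℕ) where
  semigroup : C0Semigroup H
  β : ℂ
  β_mem : β ∈ semigroup.resolventSet
  B : 𝒰 →L[ℂ] semigroup.Extrapolation β
  admissible : semigroup.IsAdmissible B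
  T : ℝ
  T_pos : 0 < T
  x₀ : H
  x_T : H
  U : Set (Lp 𝒰 2 (volume.restrict (Ioo (0 : ℝ) T)))
  U_closed : IsClosed U
  U_convex : Convex ℝ U
  θ : H → 𝒰 → Icc (0 : ℝ) T → ℝ
  g : Fin l → H → Icc (0 : ℝ) T → ℝ

namespace Problem

variable {H 𝒰 : Type*} [NormedAddCommGroup H] [InnerProductSpace ℂ H]
  [NormedAddCommGroup 𝒰] [InnerProductSpace ℂ 𝒰] {l : ℕ} (P : Problem H 𝒰 l)

/-- The space `X` of the problem. -/
abbrev Space : Type _ := StateControl H 𝒰 P.T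

/-- The initial time, as a point of `[0, T]`. -/
def initialTime : Icc (0 : ℝ) P.T := ⟨0, left_mem_Icc.2 P.T_pos.le⟩

/-- The final time, as a point of `[0, T]`. -/
def finalTime : Icc (0 : ℝ) P.T := ⟨P.T, right_mem_Icc.2 P.T_pos.le⟩

/-- The cost functional. -/
def cost (z : P.Space) : ℝ := ∫ t, P.θ (z.fst t) (z.snd t) t ∂lebesgueOn P.T

/-- `(x, u)` satisfies `x(t) = T_t x₀ + F_t u` for all `t ∈ [0, T]`
(the equality is read in `H₋₁`, of which `H` is a subspace). -/
def IsTrajectory (z : P.Space) : Prop :=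
  ∀ t : Icc (0 : ℝ) P.T, P.semigroup.embed P.β (z.fst t) =
    P.semigroup.embed P.β (P.semigroup.op (t : ℝ).toNNReal P.x₀)
      + P.semigroup.inputMap P.B t z.snd

/-- The set `A` given by the evolution equation, the end-points and the control constraint. -/
def A : Set P.Space :=
  {z | z.fst P.initialTime = P.x₀ ∧ z.fst P.finalTime = P.x_T ∧ z.snd ∈ P.U ∧ P.IsTrajectory z}

/-- The set `M` given by the state constraints. -/
def M : Set P.Space := {z | ∀ t j, P.g j (z.fst t) t ≤ 0}

/-- The `L^p` penalty term. -/
def lpPenalty (p : ℝ) (z : P.Space) : ℝ :=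
  ∑ j, (∫ t, max (P.g j (z.fst t) t) 0 ^ p ∂lebesgueOn P.T) ^ (1 / p)

/-- The `L^p` penalty function. -/
def penaltyFunction (p lam : ℝ) (z : P.Space) : ℝ := P.cost z + lam * P.lpPenalty p z

/-- The growth condition `|θ(x, u, t)| ≤ C_R ‖u‖² + ω_R(t)` for `‖x‖ ≤ R`, `t ∈ (0, T)`. -/
def ThetaGrowth : Prop :=
  ∀ R : ℝ, 0 < R → ∃ C : ℝ, 0 < C ∧ ∃ ω : ℝ → ℝ,
    IntegrableOn ω (Ioo 0 P.T) ∧ (∀ᵐ t ∂volume.restrict (Ioo 0 P.T), 0 ≤ ω t) ∧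
    ∀ (x : H) (u : 𝒰) (t : Icc (0 : ℝ) P.T), (t : ℝ) ∈ Ioo 0 P.T → ‖x‖ ≤ R →
      |P.θ x u t| ≤ C * ‖u‖ ^ 2 + ω t

/-- Slater's condition. -/
def Slater : Prop := ∃ z ∈ P.A, ∀ t j, P.g j (z.fst t) t < 0

/-- The (nonnegative) regular Borel measures `μ_j` on `[0, T]` are Lagrange multipliers
corresponding to the state constraints, `zs` being a globally optimal solution. -/
def IsLagrangeMultiplier (zs : P.Space) (μ : Fin l → Measure (Icc (0 : ℝ) P.T)) : Prop :=
  (∀ j, (μ j).Regular) ∧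
    ∀ z ∈ P.A, P.cost zs ≤ P.cost z + ∑ j, ∫ t, P.g j (z.fst t) t ∂μ j

end Problem

end ExactPenalty

end

namespace ExactPenalty

/-! ### Convex problems: local minima, inf-stationarity and exactness -/

section Convex

variable {X : Type*} [NormedAddCommGroup X] [NormedSpace ℝ X]

/-! Let `φ` be the penalty term and `c` the sum of the `L^{p'}` norms of the multiplier densities.
On `A` the multiplier inequality bounds the optimal value by `I + ∑ ∫ g_j dμ_j`. Since the densities
are nonnegative, each `g_j` may be replaced by its positive part, and Hölder's inequality gives `I*
≤ I + c φ` on `A` (`cost_le_penaltyFunction`). By continuity of the constraints, `φ` vanishes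
exactly on `M` (`lpPenalty_eq_zero_iff`). So for `λ > c` the penalty function equals `I` on `Ω` and
exceeds `I*` strictly on `A \ M`; optimal values and global minimisers therefore agree.

The local claims reduce to the global one: for a convex function on a convex set, local minimisers
and inf-stationary points are global minimisers. It remains to check that `I`, `φ`, `M` and `A` are
convex. For `A` this requires linearity of the input map, hence integrability of its integrand in
`H₋₁`, which comes from joint continuity of the extended semigroup (`continuous_opExtrapolation`).
-/

theorem isLocalSolution_iff_isGlobalSolution {f : X → ℝ} {K : Set X} (hf : ConvexOn ℝ K f) (x : X) :
    IsLocalSolution f K x ↔ IsGlobalSolution f K x :=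
  ⟨fun h => ⟨h.1, IsMinOn.of_isLocalMinOn_of_convexOn h.1 h.2 hf⟩, fun h => ⟨h.1, h.2.localize⟩⟩

/-- If some `y` in `K` has a smaller value, convexity keeps the difference quotients along the
segment from `x` to `y` below one fixed negative slope, so the lower limit is negative. At a global
minimiser all quotients are nonnegative. -/
theorem isInfStationary_iff_isGlobalSolution {f : X → ℝ} {K : Set X} (hf : ConvexOn ℝ K f) (x : X) :
    IsInfStationary f K x ↔ IsGlobalSolution f K x := by
  refine ⟨fun h => ⟨h.1, ?_⟩, fun h => ⟨h.1, ?_⟩⟩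
  · intro y hy
    by_contra hlt
    have hlt : f y < f x := not_le.1 hlt
    have hne : y ≠ x := by rintro rfl; exact lt_irrefl _ hlt
    have hd : 0 < dist y x := dist_pos.2 hne
    set c := (f y - f x) / dist y x with hc
    have hc0 : c < 0 := div_neg_of_neg_of_pos (sub_neg.2 hlt) hd
    have hray : Tendsto (fun s : ℝ => x + s • (y - x)) (𝓝[>] 0) (𝓝[K \ {x}] x) := by
      refine tendsto_nhdsWithin_iff.2 ⟨?_, ?_⟩
      · have : Continuous fun s : ℝ => x + s • (y - x) := by fun_prop
        simpa using (this.tendsto 0).mono_left nhdsWithin_le_nhds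
      · filter_upwards [Ioo_mem_nhdsGT (zero_lt_one' ℝ)] with s hs
        refine ⟨hf.1.add_smul_sub_mem h.1 hy ⟨hs.1.le, hs.2.le⟩, ?_⟩
        simp [sub_eq_zero, hne, hs.1.ne']
    have hfreq : ∃ᶠ z in 𝓝[K \ {x}] x, (((f z - f x) / dist z x : ℝ) : EReal) ≤ (c : EReal) := by
      refine hray.frequently (Eventually.frequently ?_)
      filter_upwards [Ioo_mem_nhdsGT (zero_lt_one' ℝ)] with s hs
      have h1 : f (x + s • (y - x)) ≤ (1 - s) * f x + s * f y := by
        have := hf.2 h.1 hy (sub_nonneg.2 hs.2.le) hs.1.le (by ring)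
        rw [show x + s • (y - x) = (1 - s) • x + s • y by module]
        simpa using this
      have h2 : dist (x + s • (y - x)) x = s * dist y x := by
        rw [dist_eq_norm, dist_eq_norm, add_sub_cancel_left, norm_smul, Real.norm_of_nonneg hs.1.le]
      rw [EReal.coe_le_coe_iff, h2, hc, div_le_div_iff₀ (mul_pos hs.1 hd) hd]
      nlinarith
    have := h.2.trans (liminf_le_of_frequently_le hfreq)
    exact absurd (EReal.coe_nonneg.1 this) (not_le.2 hc0)
  · refine le_liminf_of_le (by isBoundedDefault) ?_
    filter_upwards [self_mem_nhdsWithin] with y hy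
    exact EReal.coe_nonneg.2 (div_nonneg (sub_nonneg.2 (h.2 hy.1)) dist_nonneg)

theorem iInf_eq_of_isGlobalSolution {X : Type*} [MetricSpace X] {f : X → ℝ} {K : Set X} {x : X} (h : IsGlobalSolution f K x) :
    (⨅ y ∈ K, (f y : EReal)) = f x :=
  le_antisymm (iInf₂_le x h.1) (le_iInf₂ fun _ hy => EReal.coe_le_coe_iff.2 (h.2 hy))

/-- A convex penalty function whose minimisers are the minimisers of the original problem
is completely exact. -/
theorem isCompletelyExactOn_of_convexOn {I Phi : X → ℝ} {M A : Set X}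
    (hI : ConvexOn ℝ (M ∩ A) I) (hPhi : ConvexOn ℝ A Phi) {x₀ : X}
    (hx₀ : IsGlobalSolution I (M ∩ A) x₀) (heq : ∀ x ∈ M ∩ A, Phi x = I x)
    (hle : ∀ x ∈ A, I x₀ ≤ Phi x) (hlt : ∀ x ∈ A, x ∉ M → I x₀ < Phi x) :
    IsCompletelyExactOn I Phi M A A := by
  have hPx₀ : IsGlobalSolution Phi A x₀ :=
    ⟨hx₀.1.2, fun y hy => (heq x₀ hx₀.1).trans_le (hle y hy)⟩
  have hglob : ∀ x, IsGlobalSolution Phi A x ↔ IsGlobalSolution I (M ∩ A) x := by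
    intro x
    refine ⟨fun h => ?_, fun h => ⟨h.1.2, fun y hy => ?_⟩⟩
    · have hxI : Phi x ≤ I x₀ := (h.2 hx₀.1.2).trans_eq (heq x₀ hx₀.1)
      have hxM : x ∈ M := by
        by_contra hxM
        exact absurd (hlt x h.1 hxM) (not_lt.2 hxI)
      exact ⟨⟨hxM, h.1⟩, fun y hy => ((heq x ⟨hxM, h.1⟩).ge.trans hxI).trans (hx₀.2 hy)⟩
    · exact ((heq x h.1).trans_le (h.2 hx₀.1)).trans (hle y hy)
  refine ⟨?_, hglob, fun x _ => ?_, fun x _ => ?_⟩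
  · rw [iInf_eq_of_isGlobalSolution hx₀, iInf_eq_of_isGlobalSolution hPx₀, heq x₀ hx₀.1]
  · rw [isLocalSolution_iff_isGlobalSolution hPhi, isLocalSolution_iff_isGlobalSolution hI, hglob]
  · rw [isInfStationary_iff_isGlobalSolution hPhi, isInfStationary_iff_isGlobalSolution hI, hglob]

end Convex

/-! ### The extended semigroup and linearity of the input map -/

theorem intervalIntegrable_of_family {E F : Type*} [NormedAddCommGroup E] [NormedAddCommGroup F]
    {Φ : ℝ≥0 → E → F} {t C : ℝ} (ht : 0 ≤ t) (hΦ : Continuous fun q : ℝ≥0 × E => Φ q.1 q.2)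
    (hbound : ∀ s ≤ t.toNNReal, ∀ v, ‖Φ s v‖ ≤ C * ‖v‖) {u : ℝ → E}
    (hu : IntegrableOn u (Ioc 0 t)) :
    IntervalIntegrable (fun σ => Φ (t - σ).toNNReal (u σ)) volume 0 t := by
  rw [intervalIntegrable_iff_integrableOn_Ioc_of_le ht]
  refine Integrable.mono' (hu.norm.const_mul C) ?_ ?_
  · have hpair : AEStronglyMeasurable (fun σ => ((t - σ).toNNReal, u σ))
        (volume.restrict (Ioc 0 t)) :=
      (Continuous.aestronglyMeasurable (by fun_prop)).prodMk hu.1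
    exact hΦ.comp_aestronglyMeasurable hpair
  · refine (ae_restrict_mem measurableSet_Ioc).mono fun σ hσ => ?_
    exact hbound _ (Real.toNNReal_le_toNNReal (by linarith [hσ.1])) _

namespace C0Semigroup

variable {H : Type*} [NormedAddCommGroup H] [NormedSpace ℂ H] (S : C0Semigroup H)

/-- Orbits are continuous, hence bounded on the compact interval `[0, t]`; uniform boundedness does
the rest. -/
theorem exists_norm_op_le [CompleteSpace H] (t : ℝ≥0) : ∃ C, 0 ≤ C ∧ ∀ s ≤ t, ‖S.op s‖ ≤ C := by
  obtain ⟨C, hC⟩ := banach_steinhaus (g := fun s : Iic t => S.op s) fun z => by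
    obtain ⟨C, hC⟩ := (isCompact_Icc (a := (0 : ℝ≥0)) (b := t)).exists_bound_of_continuousOn
      (S.continuous_orbit z).continuousOn
    exact ⟨C, fun s => hC s ⟨zero_le, s.2⟩⟩
  exact ⟨C, (norm_nonneg _).trans (hC ⟨t, self_mem_Iic⟩), fun s hs => hC ⟨s, hs⟩⟩

theorem norm_opExtrapolation_apply_le (β : ℂ) (t : ℝ≥0) (v : S.Extrapolation β) :
    ‖S.opExtrapolation β t v‖ ≤ ‖S.op t‖ * ‖v‖ := by
  induction v using UniformSpace.Completion.induction_on with
  | hp => exact isClosed_le (by fun_prop) (by fun_prop)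
  | ih z =>
    have h : S.opExtrapolation β t (z : S.Extrapolation β) = (S.opResolventNormed β t z :) :=
      UniformSpace.Completion.map_coe (S.opResolventNormed β t).uniformContinuous _
    rw [h, UniformSpace.Completion.norm_coe, UniformSpace.Completion.norm_coe]
    refine (S.opResolventNormed β t).le_of_opNorm_le ?_ z
    exact LinearMap.mkContinuous_norm_le _ (norm_nonneg _) _

theorem embed_add (β : ℂ) (z w : H) : S.embed β (z + w) = S.embed β z + S.embed β w := by
  simp [embed, UniformSpace.Completion.coe_add]

theorem embed_smul (β : ℂ) (c : ℂ) (z : H) : S.embed β (c • z) = c • S.embed β z := by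
  simp [embed, UniformSpace.Completion.coe_smul]

theorem norm_embed (β : ℂ) (z : H) : ‖S.embed β z‖ = ‖S.resolvent β z‖ :=
  UniformSpace.Completion.norm_coe _

theorem continuous_embed (β : ℂ) : Continuous (S.embed β) := by
  let f : H →+ S.Extrapolation β := AddMonoidHom.mk' (S.embed β) (S.embed_add β)
  refine AddMonoidHomClass.continuous_of_bound f ‖S.resolvent β‖ fun z => ?_
  exact (S.norm_embed β z).trans_le ((S.resolvent β).le_opNorm z)

/-- Orbits starting in the dense image of `H` are continuous, and the operators are bounded
uniformly for times near `s₀`; a three-term estimate passes to the completion. -/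
theorem continuous_opExtrapolation [CompleteSpace H] (β : ℂ) :
    Continuous fun q : ℝ≥0 × S.Extrapolation β => S.opExtrapolation β q.1 q.2 := by
  rw [continuous_iff_continuousAt]
  rintro ⟨s₀, v₀⟩
  obtain ⟨C, hC0, hC⟩ := S.exists_norm_op_le (s₀ + 1)
  have hbd : ∀ s ≤ s₀ + 1, ∀ v, ‖S.opExtrapolation β s v‖ ≤ C * ‖v‖ := fun s hs v =>
    (S.norm_opExtrapolation_apply_le β s v).trans
      (mul_le_mul_of_nonneg_right (hC s hs) (norm_nonneg _))
  rw [ContinuousAt, Metric.tendsto_nhds]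
  intro ε hε
  -- The three summands bound the error from replacing the vector by `embed z` at time `q.1`
  -- (distance at most `2δ`), the change of time along the orbit of `z`, and the return from `embed
  -- z` to `v₀` at time `s₀`.
  obtain ⟨δ, hδ, hδε⟩ : ∃ δ : ℝ, 0 < δ ∧ C * (δ + δ) + δ + C * δ < ε := by
    refine ⟨ε / (2 * (3 * C + 1)), by positivity, ?_⟩
    have : C * (ε / (2 * (3 * C + 1)) + ε / (2 * (3 * C + 1))) + ε / (2 * (3 * C + 1))
      + C * (ε / (2 * (3 * C + 1))) = ε / 2 := by field_simp; ring
    linarith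
  obtain ⟨w, hw⟩ := UniformSpace.Completion.denseRange_coe.exists_dist_lt v₀ hδ
  obtain ⟨z, rfl⟩ := (toResolventNormed (S.resolvent β)).surjective w
  change dist v₀ (S.embed β z) < δ at hw
  have horb : Tendsto (fun s => S.embed β (S.op s z)) (𝓝 s₀) (𝓝 (S.embed β (S.op s₀ z))) :=
    ((S.continuous_embed β).comp (S.continuous_orbit z)).tendsto s₀
  rw [nhds_prod_eq]
  filter_upwards [((Metric.tendsto_nhds.1 horb δ hδ).and
    (Iic_mem_nhds (lt_add_one s₀))).prod_mk (Metric.ball_mem_nhds v₀ hδ)] with q ⟨⟨h1, h2⟩, h3⟩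
  rw [dist_eq_norm] at h1 hw ⊢
  have h3 : ‖q.2 - v₀‖ < δ := mem_ball_iff_norm.1 h3
  rw [← S.opExtrapolation_embed, ← S.opExtrapolation_embed] at h1
  have e1 := hbd q.1 h2 (q.2 - S.embed β z)
  have e2 := hbd s₀ (by simp) (S.embed β z - v₀)
  have e3 : ‖q.2 - S.embed β z‖ ≤ δ + δ := by
    rw [← sub_add_sub_cancel q.2 v₀]
    exact (norm_add_le _ _).trans (add_le_add h3.le hw.le)
  rw [norm_sub_rev] at hw
  have key : S.opExtrapolation β q.1 q.2 - S.opExtrapolation β s₀ v₀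
      = S.opExtrapolation β q.1 (q.2 - S.embed β z)
        + (S.opExtrapolation β q.1 (S.embed β z) - S.opExtrapolation β s₀ (S.embed β z))
        + S.opExtrapolation β s₀ (S.embed β z - v₀) := by
    simp only [map_sub]; abel
  rw [key]
  calc _ ≤ _ := norm_add₃_le
    _ ≤ C * (δ + δ) + δ + C * δ := by
      gcongr
      · exact e1.trans (by gcongr)
      · exact e2.trans (by gcongr)
    _ < ε := hδε

variable {𝒰 : Type*} [NormedAddCommGroup 𝒰] [NormedSpace ℂ 𝒰]

theorem intervalIntegrable_input [CompleteSpace H] {β : ℂ} (B : 𝒰 →L[ℂ] S.Extrapolation β)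
    {t : ℝ} (ht : 0 ≤ t) {u : ℝ → 𝒰} (hu : IntegrableOn u (Ioc 0 t)) :
    IntervalIntegrable (fun σ => S.opExtrapolation β (t - σ).toNNReal (B (u σ))) volume 0 t := by
  obtain ⟨C, -, hC⟩ := S.exists_norm_op_le t.toNNReal
  refine intervalIntegrable_of_family (C := C) (Φ := fun s v => S.opExtrapolation β s v) ht
    (S.continuous_opExtrapolation β) (fun s hs v => ?_) (B.integrable_comp hu)
  exact (S.norm_opExtrapolation_apply_le β s v).trans
    (mul_le_mul_of_nonneg_right (hC s hs) (norm_nonneg _))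

/-- The combination is assumed only almost everywhere because representatives of `L²` classes add
only almost everywhere. -/
theorem inputMap_combination [CompleteSpace H] {β : ℂ} (B : 𝒰 →L[ℂ] S.Extrapolation β)
    {t : ℝ} (ht : 0 ≤ t) {u v w : ℝ → 𝒰} (hu : IntegrableOn u (Ioc 0 t))
    (hv : IntegrableOn v (Ioc 0 t)) (a b : ℂ)
    (hw : ∀ᵐ σ ∂volume.restrict (Ioc 0 t), w σ = a • u σ + b • v σ) :
    S.inputMap B t w = a • S.inputMap B t u + b • S.inputMap B t v := by
  unfold inputMap
  have hadd := intervalIntegral.integral_add ((S.intervalIntegrable_input B ht hu).smul a)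
    ((S.intervalIntegrable_input B ht hv).smul b)
  simp only [Pi.smul_apply] at hadd
  rw [← intervalIntegral.integral_smul, ← intervalIntegral.integral_smul, ← hadd]
  refine intervalIntegral.integral_congr_ae_restrict ?_
  rw [uIoc_of_le ht]
  filter_upwards [hw] with σ hσ
  simp [hσ]

end C0Semigroup

/-! ### Lebesgue measure on `[0, T]` and Hölder's inequality -/

section LebesgueOn

theorem measurePreserving_lebesgueOn (T : ℝ) :
    MeasurePreserving Subtype.val (lebesgueOn T) (volume.restrict (Ioo (0 : ℝ) T)) := by
  rw [Measure.restrict_congr_set Ioo_ae_eq_Icc]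
  exact measurePreserving_subtype_coe measurableSet_Icc

instance isFiniteMeasure_lebesgueOn (T : ℝ) : IsFiniteMeasure (lebesgueOn T) :=
  ⟨by
    rw [← preimage_univ (f := Subtype.val),
      (measurePreserving_lebesgueOn T).measure_preimage MeasurableSet.univ.nullMeasurableSet]
    exact measure_lt_top _ _⟩

/-- Every point of `[0, T]`, end-points included, is a limit of points of `(0, T)`, so a nonempty
relatively open set meets `(0, T)` in a nonempty open set. -/
theorem isOpenPosMeasure_lebesgueOn {T : ℝ} (hT : 0 < T) : (lebesgueOn T).IsOpenPosMeasure := by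
  refine ⟨fun V hV ⟨x, hx⟩ => ?_⟩
  obtain ⟨O, hO, rfl⟩ := isOpen_induced_iff.1 hV
  rw [(measurePreserving_lebesgueOn T).measure_preimage hO.measurableSet.nullMeasurableSet,
    Measure.restrict_apply hO.measurableSet]
  have hxc : (x : ℝ) ∈ closure (Ioo 0 T) := by
    rw [closure_Ioo hT.ne]
    exact x.2
  exact ((hO.inter isOpen_Ioo).measure_pos volume (mem_closure_iff.1 hxc O hO hx)).ne'

end LebesgueOn

/-- Hölder's inequality in terms of `lpNorm`. -/
theorem integral_mul_le_lpNorm_mul_lpNorm {α : Type*} [MeasurableSpace α] {ν : Measure α}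
    {p q : ℝ≥0∞} [p.HolderConjugate q] {f g : α → ℝ} (hf : MemLp f p ν) (hg : MemLp g q ν) :
    ∫ a, f a * g a ∂ν ≤ lpNorm f p ν * lpNorm g q ν := by
  have hfg : MemLp (f • g) 1 ν := hg.smul hf
  calc ∫ a, f a * g a ∂ν ≤ ∫ a, ‖(f • g) a‖ ∂ν :=
        integral_mono (memLp_one_iff_integrable.1 hfg) (memLp_one_iff_integrable.1 hfg).norm
          fun a => le_abs_self _
    _ = (eLpNorm (f • g) 1 ν).toReal := by
        rw [toReal_eLpNorm hfg.1, lpNorm_one_eq_integral_norm hfg.1]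
    _ ≤ (eLpNorm f p ν * eLpNorm g q ν).toReal :=
        ENNReal.toReal_mono (ENNReal.mul_ne_top hf.eLpNorm_ne_top hg.eLpNorm_ne_top)
          (eLpNorm_smul_le_mul_eLpNorm hg.1 hf.1)
    _ = _ := by rw [ENNReal.toReal_mul, toReal_eLpNorm hf.1, toReal_eLpNorm hg.1]

/-- If `ν₁` has density `ρ` in `L^{p'}` with respect to `ν`, then `∫ f dν₁ ≤ ‖ρ‖ ‖f⁺‖_p`. -/
theorem integral_le_lpNorm_rnDeriv_mul {α : Type*} [MeasurableSpace α] {ν ν₁ : Measure α}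
    [SigmaFinite ν] [SigmaFinite ν₁] (hac : ν₁ ≪ ν) {p p' : ℝ≥0∞} [p'.HolderConjugate p]
    (hρ : MemLp (fun a => (ν₁.rnDeriv ν a).toReal) p' ν) {f : α → ℝ} (hf : MemLp f p ν) :
    ∫ a, f a ∂ν₁ ≤ lpNorm (fun a => (ν₁.rnDeriv ν a).toReal) p' ν *
      lpNorm (fun a => max (f a) 0) p ν := by
  have hf' : MemLp (fun a => max (f a) 0) p ν := hf.pos_part
  rw [← integral_rnDeriv_smul hac]
  refine le_trans (integral_mono ?_ ?_ fun a => ?_) (integral_mul_le_lpNorm_mul_lpNorm hρ hf')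
  · exact memLp_one_iff_integrable.1 (hf.smul hρ)
  · exact memLp_one_iff_integrable.1 (hf'.smul hρ)
  · exact mul_le_mul_of_nonneg_left (le_max_left _ _) ENNReal.toReal_nonneg

/-! ### Convexity of the feasible sets and of the cost -/

namespace Problem

variable {H 𝒰 : Type*} [NormedAddCommGroup H] [InnerProductSpace ℂ H]
  [NormedAddCommGroup 𝒰] [InnerProductSpace ℂ 𝒰] {l : ℕ} (P : Problem H 𝒰 l)

theorem integrableOn_control (z : P.Space) (t : Icc (0 : ℝ) P.T) :
    IntegrableOn z.snd (Ioc 0 (t : ℝ)) := by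
  have h : IntegrableOn z.snd (Ioo 0 P.T) := (Lp.memLp z.snd).integrable one_le_two
  exact ((integrableOn_Ioc_iff_integrableOn_Ioo enorm_ne_top).2 h).mono_set (Ioc_subset_Ioc_right t.2.2)

theorem coeFn_snd_combination (z w : P.Space) (a b : ℝ) :
    (a • z + b • w).snd =ᵐ[volume.restrict (Ioo 0 P.T)] fun s => a • z.snd s + b • w.snd s := by
  filter_upwards [Lp.coeFn_add (a • z.snd) (b • w.snd), Lp.coeFn_smul a z.snd,
    Lp.coeFn_smul b w.snd] with s h1 h2 h3
  rw [Pi.smul_apply] at h2 h3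
  rw [← h2, ← h3]
  exact h1

theorem fst_combination_apply (z w : P.Space) (a b : ℝ) (t : Icc (0 : ℝ) P.T) :
    (a • z + b • w).fst t = a • z.fst t + b • w.fst t := rfl

theorem convex_A [CompleteSpace H] : Convex ℝ P.A := by
  rintro z ⟨hz0, hzT, hzU, hz⟩ w ⟨hw0, hwT, hwU, hw⟩ a b ha hb hab
  refine ⟨?_, ?_, P.U_convex hzU hwU ha hb hab, fun t => ?_⟩
  · rw [fst_combination_apply, hz0, hw0, Convex.combo_self hab]
  · rw [fst_combination_apply, hzT, hwT, Convex.combo_self hab]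
  · have hae : ∀ᵐ s ∂volume.restrict (Ioc 0 (t : ℝ)),
        (a • z + b • w).snd s = (a : ℂ) • z.snd s + (b : ℂ) • w.snd s := by
      have hle : volume.restrict (Ioc 0 (t : ℝ)) ≤ volume.restrict (Ioo 0 P.T) :=
        (Measure.restrict_mono (Ioc_subset_Ioc_right t.2.2) le_rfl).trans_eq
          (Measure.restrict_congr_set Ioo_ae_eq_Ioc.symm)
      filter_upwards [ae_mono hle (P.coeFn_snd_combination z w a b)] with s hs
      simpa only [Complex.coe_smul] using hs
    have hab' : (a : ℂ) + b = 1 := by exact_mod_cast hab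
    rw [P.semigroup.inputMap_combination P.B t.2.1 (P.integrableOn_control z t)
      (P.integrableOn_control w t) a b hae, fst_combination_apply, ← Complex.coe_smul,
      ← Complex.coe_smul, P.semigroup.embed_add, P.semigroup.embed_smul, P.semigroup.embed_smul,
      hz t, hw t]
    -- The state equation is affine: the free term `T_t x₀` on the right is written as `(a + b)`
    -- times itself to match the two copies on the left.
    nth_rw 3 [← one_smul ℂ (P.semigroup.embed P.β _)]
    rw [← hab']
    module

theorem convex_M (hg : ∀ j t, ConvexOn ℝ univ fun x : H => P.g j x t) : Convex ℝ P.M := by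
  intro z hz w hw a b ha hb hab t j
  exact ((hg j t).convex_le 0 ⟨mem_univ _, hz t j⟩ ⟨mem_univ _, hw t j⟩ ha hb hab).2

theorem integrable_cost_integrand
    (hθ : Continuous fun q : H × 𝒰 × Icc (0 : ℝ) P.T => P.θ q.1 q.2.1 q.2.2)
    (hgrowth : P.ThetaGrowth) (z : P.Space) :
    Integrable (fun t : Icc (0 : ℝ) P.T => P.θ (z.fst t) (z.snd t) t) (lebesgueOn P.T) := by
  -- The `+ 1` keeps the radius positive when the trajectory vanishes.
  obtain ⟨C, hC, ω, hω, -, hle⟩ := hgrowth (‖z.fst‖ + 1) (by positivity)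
  have hmp := measurePreserving_lebesgueOn P.T
  have hu : MemLp (fun t : Icc (0 : ℝ) P.T => z.snd t) 2 (lebesgueOn P.T) :=
    (Lp.memLp z.snd).comp_measurePreserving hmp
  have hω' : Integrable (fun t : Icc (0 : ℝ) P.T => ω t) (lebesgueOn P.T) :=
    hmp.integrable_comp_of_integrable hω
  have hu2 : Integrable (fun t : Icc (0 : ℝ) P.T => ‖z.snd t‖ ^ 2) (lebesgueOn P.T) :=
    hu.integrable_norm_pow two_ne_zero
  refine Integrable.mono' ((hu2.const_mul C).add hω') ?_ ?_
  · exact hθ.comp_aestronglyMeasurable (z.fst.continuous.aestronglyMeasurable.prodMk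
      (hu.1.prodMk continuous_id.aestronglyMeasurable))
  · filter_upwards [hmp.quasiMeasurePreserving.ae (ae_restrict_mem measurableSet_Ioo)] with t ht
    exact hle _ _ t ht ((z.fst.norm_coe_le_norm t).trans (by linarith))

theorem convexOn_cost (hθ : Continuous fun q : H × 𝒰 × Icc (0 : ℝ) P.T => P.θ q.1 q.2.1 q.2.2)
    (hgrowth : P.ThetaGrowth)
    (hconv : ∀ t, ConvexOn ℝ univ fun q : H × 𝒰 => P.θ q.1 q.2 t) :
    ConvexOn ℝ univ P.cost := by
  refine ⟨convex_univ, fun z _ w _ a b ha hb hab => ?_⟩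
  have hz := P.integrable_cost_integrand hθ hgrowth z
  have hw := P.integrable_cost_integrand hθ hgrowth w
  simp only [cost, smul_eq_mul]
  rw [← integral_const_mul, ← integral_const_mul,
    ← integral_add (hz.const_mul a) (hw.const_mul b)]
  refine integral_mono_ae (P.integrable_cost_integrand hθ hgrowth _)
    ((hz.const_mul a).add (hw.const_mul b)) ?_
  filter_upwards [(measurePreserving_lebesgueOn P.T).quasiMeasurePreserving.ae
    (P.coeFn_snd_combination z w a b)] with t ht
  rw [ht]
  exact (hconv t).2 (mem_univ (z.fst t, z.snd t)) (mem_univ (w.fst t, w.snd t)) ha hb hab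

/-! ### The penalty term: convexity, zero set, lower bound -/

section Penalty

variable (hg : ∀ j, Continuous fun q : H × Icc (0 : ℝ) P.T => P.g j q.1 q.2)
include hg

theorem continuous_constraint (j : Fin l) (z : P.Space) :
    Continuous fun t => P.g j (z.fst t) t :=
  (hg j).comp (z.fst.continuous.prodMk continuous_id)

theorem memLp_constraint (j : Fin l) (z : P.Space) (p : ℝ≥0∞) :
    MemLp (fun t => P.g j (z.fst t) t) p (lebesgueOn P.T) :=
  (P.continuous_constraint hg j z).memLp_of_hasCompactSupport
    (HasCompactSupport.of_compactSpace _)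

theorem lpPenalty_eq {p : ℝ} (hp : 1 ≤ p) (z : P.Space) :
    P.lpPenalty p z =
      ∑ j, lpNorm (fun t => max (P.g j (z.fst t) t) 0) (ENNReal.ofReal p) (lebesgueOn P.T) := by
  have hp0 : 0 < p := zero_lt_one.trans_le hp
  refine Finset.sum_congr rfl fun j _ => ?_
  rw [lpNorm_eq_integral_norm_rpow_toReal (by simpa using hp0) ENNReal.ofReal_ne_top
    (P.memLp_constraint hg j z 1).pos_part.1, ENNReal.toReal_ofReal hp0.le, one_div]
  simp only [Real.norm_of_nonneg (le_max_right _ (0 : ℝ))]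

/-- The positive part of a convex function is convex, the `L^p` norm is monotone on nonnegative
functions, and Minkowski's inequality splits the sum. -/
theorem convexOn_lpPenalty (hconv : ∀ j t, ConvexOn ℝ univ fun x : H => P.g j x t)
    {p : ℝ} (hp : 1 ≤ p) : ConvexOn ℝ univ (P.lpPenalty p) := by
  refine ⟨convex_univ, fun z _ w _ a b ha hb hab => ?_⟩
  simp only [P.lpPenalty_eq hg hp, smul_eq_mul, Finset.mul_sum, ← Finset.sum_add_distrib]
  refine Finset.sum_le_sum fun j _ => ?_
  set q := ENNReal.ofReal p
  have hq : 1 ≤ q := ENNReal.one_le_ofReal.2 hp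
  have hz := ((P.memLp_constraint hg j z q).pos_part).const_smul a
  have hw := ((P.memLp_constraint hg j w q).pos_part).const_smul b
  refine ((lpNorm_mono_real (hz.add hw) fun t => ?_).trans (lpNorm_add_le hz hq)).trans_eq ?_
  · rw [Real.norm_of_nonneg (le_max_right _ _)]
    have h := (hconv j t).2 (mem_univ (z.fst t)) (mem_univ (w.fst t)) ha hb hab
    simp only [Pi.add_apply, Pi.smul_apply, smul_eq_mul, fst_combination_apply] at h ⊢
    refine max_le (h.trans ?_) (by positivity)
    gcongr <;> exact le_max_left _ _
  · rw [lpNorm_const_smul, lpNorm_const_smul]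
    simp [abs_of_nonneg ha, abs_of_nonneg hb]

omit hg in
theorem lpPenalty_nonneg (p : ℝ) (z : P.Space) : 0 ≤ P.lpPenalty p z :=
  Finset.sum_nonneg fun _ _ => Real.rpow_nonneg (integral_nonneg fun _ =>
    Real.rpow_nonneg (le_max_right _ _) _) _

/-- A zero norm gives the constraint only almost everywhere; continuity and the full support of
Lebesgue measure extend it to every `t`. -/
theorem lpPenalty_eq_zero_iff {p : ℝ} (hp : 1 ≤ p) (z : P.Space) :
    P.lpPenalty p z = 0 ↔ z ∈ P.M := by
  have := isOpenPosMeasure_lebesgueOn P.T_pos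
  have hp0 : 0 < p := zero_lt_one.trans_le hp
  rw [P.lpPenalty_eq hg hp, Finset.sum_eq_zero_iff_of_nonneg fun _ _ => lpNorm_nonneg]
  have key : ∀ j, lpNorm (fun t => max (P.g j (z.fst t) t) 0) (ENNReal.ofReal p)
      (lebesgueOn P.T) = 0 ↔ ∀ t, P.g j (z.fst t) t ≤ 0 := by
    intro j
    rw [lpNorm_eq_zero (P.memLp_constraint hg j z _).pos_part (by simpa using hp0),
      ((P.continuous_constraint hg j z).max continuous_const).ae_eq_iff_eq (lebesgueOn P.T)
        continuous_zero, funext_iff]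
    simp
  simp only [key, Finset.mem_univ, true_implies]
  exact forall_comm

/-- The sum of the `L^{p'}` norms of the densities of the multipliers is an exact penalty
parameter. -/
theorem cost_le_penaltyFunction {p : ℝ} (hp : 1 ≤ p) {p' : ℝ≥0∞}
    [hpp' : (ENNReal.ofReal p).HolderConjugate p'] {zs : P.Space}
    {μ : Fin l → Measure (Icc (0 : ℝ) P.T)} (hμ : P.IsLagrangeMultiplier zs μ)
    (hac : ∀ j, μ j ≪ lebesgueOn P.T)
    (hdens : ∀ j, MemLp (fun t => ((μ j).rnDeriv (lebesgueOn P.T) t).toReal) p' (lebesgueOn P.T))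
    {z : P.Space} (hz : z ∈ P.A) :
    P.cost zs ≤ P.penaltyFunction p
      (∑ j, lpNorm (fun t => ((μ j).rnDeriv (lebesgueOn P.T) t).toReal) p' (lebesgueOn P.T)) z := by
  have := hpp'.symm
  refine (hμ.2 z hz).trans (add_le_add le_rfl ?_)
  rw [P.lpPenalty_eq hg hp, Finset.mul_sum]
  refine Finset.sum_le_sum fun j _ => ?_
  have := hμ.1 j
  refine (integral_le_lpNorm_rnDeriv_mul (hac j) (hdens j)
    (P.memLp_constraint hg j z (ENNReal.ofReal p))).trans ?_
  refine mul_le_mul_of_nonneg_right ?_ lpNorm_nonneg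
  -- Each density norm is enlarged to the full sum, so that one constant multiplies all the penalty
  -- terms.
  exact Finset.single_le_sum (f := fun j =>
    lpNorm (fun t => ((μ j).rnDeriv (lebesgueOn P.T) t).toReal) p' (lebesgueOn P.T))
    (fun _ _ => lpNorm_nonneg) (Finset.mem_univ j)

end Penalty

end Problem

end ExactPenalty

theorem mainTheorem6 {H 𝒰 : Type*} [NormedAddCommGroup H] [InnerProductSpace ℂ H] [CompleteSpace H]
    [NormedAddCommGroup 𝒰] [InnerProductSpace ℂ 𝒰] [CompleteSpace 𝒰] {l : ℕ}
    (P : ExactPenalty.Problem H 𝒰 l)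
    (hθ_cont : Continuous fun q : H × 𝒰 × Icc (0 : ℝ) P.T => P.θ q.1 q.2.1 q.2.2)
    (hθ_growth : P.ThetaGrowth)
    (hθ_convex : ∀ t, ConvexOn ℝ univ fun q : H × 𝒰 => P.θ q.1 q.2 t)
    (zs : P.Space) (hzs : ExactPenalty.IsGlobalSolution P.cost (P.M ∩ P.A) zs)
    (hg_convex : ∀ j t, ConvexOn ℝ univ fun x : H => P.g j x t)
    (hg_cont : ∀ j, Continuous fun q : H × Icc (0 : ℝ) P.T => P.g j q.1 q.2)
    (hSlater : P.Slater)
    (p : ℝ) (hp : 1 ≤ p) (p' : ℝ≥0∞) (hpp' : (ENNReal.ofReal p).HolderConjugate p')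
    (μ : Fin l → Measure (Icc (0 : ℝ) P.T)) (hμ : P.IsLagrangeMultiplier zs μ)
    (hμ_ac : ∀ j, μ j ≪ ExactPenalty.lebesgueOn P.T)
    (hμ_dens : ∀ j, MemLp (fun t => ((μ j).rnDeriv (ExactPenalty.lebesgueOn P.T) t).toReal) p'
      (ExactPenalty.lebesgueOn P.T)) :
    ∃ lamStar : ℝ, 0 ≤ lamStar ∧ ∀ lam : ℝ, lamStar ≤ lam →
      ExactPenalty.IsCompletelyExactOn P.cost (P.penaltyFunction p lam) P.M P.A P.A := by
  set c := ∑ j, lpNorm (fun t => ((μ j).rnDeriv (ExactPenalty.lebesgueOn P.T) t).toReal) p'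
    (ExactPenalty.lebesgueOn P.T)
  have hc : 0 ≤ c := Finset.sum_nonneg fun _ _ => lpNorm_nonneg
  -- With `c` itself the bound is not strict, and points outside `M` might also minimise; any margin
  -- above `c` excludes them.
  refine ⟨c + 1, by positivity, fun lam hlam => ?_⟩
  have hlam0 : 0 ≤ lam := by linarith
  have hcost := P.convexOn_cost hθ_cont hθ_growth hθ_convex
  have hpen := hcost.add ((P.convexOn_lpPenalty hg_cont hg_convex hp).smul hlam0)
  have hbase : ∀ z ∈ P.A, P.cost zs ≤ P.cost z + c * P.lpPenalty p z := fun z hz =>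
    P.cost_le_penaltyFunction hg_cont hp hμ hμ_ac hμ_dens hz
  refine ExactPenalty.isCompletelyExactOn_of_convexOn
    (hcost.subset (subset_univ _) ((P.convex_M hg_convex).inter P.convex_A))
    (hpen.subset (subset_univ _) P.convex_A) hzs (fun z hz => ?_) (fun z hz => ?_)
    (fun z hz hzM => ?_)
  · rw [ExactPenalty.Problem.penaltyFunction, (P.lpPenalty_eq_zero_iff hg_cont hp z).2 hz.1,
      mul_zero, add_zero]
  · have h0 := P.lpPenalty_nonneg p z
    refine (hbase z hz).trans (add_le_add le_rfl (mul_le_mul_of_nonneg_right ?_ h0))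
    linarith
  · have h0 := (P.lpPenalty_nonneg p z).lt_of_ne' fun h =>
      hzM ((P.lpPenalty_eq_zero_iff hg_cont hp z).1 h)
    refine (hbase z hz).trans_lt (add_lt_add_right (mul_lt_mul_of_pos_right ?_ h0) _)
    linarith
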